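/- For an integer $n\ge 2$ let $R_n$ be the linear hexagonal cylinder chain: the graph with $4n$ vertices $p_i,u_i,q_i,v_i$ ($i\in\mathbb{Z}/n\mathbb{Z}$, so that $p_0=p_n$, etc.) and $5n$ edges $p_iu_i,\ u_ip_{i+1},\ q_iv_i,\ v_iq_{i+1},\ p_iq_i$; its $n$ hexagons are the 6-cycles $p_{i-1},u_{i-1},p_i,q_i,v_{i-1},q_{i-1}$. Let $r(a,b)$ be the resistance distance in $R_n$, i.e. the effective resistance between $a$ and $b$ when every edge is a unit resistor. Then \begin{align*} r(p_1,p_1)<r(p_1,p_2)<\dots<r(p_1,p_{\lfloor\frac{n+2}{2}\rfloor})&=r(p_1,p_{\lceil\frac{n+2}{2}\rceil})>\dots>r(p_1,p_n),\\ r(p_1,q_1)<r(p_1,q_2)<\dots<r(p_1,q_{\lfloor\frac{n+2}{2}\rfloor})&=r(p_1,q_{\lceil\frac{n+2}{2}\rceil})>\dots>r(p_1,q_n),\\ r(u_1,u_1)<r(u_1,u_2)<\dots<r(u_1,u_{\lfloor\frac{n+2}{2}\rfloor})&=r(u_1,u_{\lceil\frac{n+2}{2}\rceil})>\dots>r(u_1,u_n),\\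 r(u_1,v_1)<r(u_1,v_2)<\dots<r(u_1,v_{\lfloor\frac{n+2}{2}\rfloor})&=r(u_1,v_{\lceil\frac{n+2}{2}\rceil})>\dots>r(u_1,v_n)\quad(\text{if } n\ge 3),\\ r(p_1,u_1)<r(p_1,u_2)<\dots<r(p_1,u_{\lfloor\frac{n+1}{2}\rfloor})&=r(p_1,u_{\lceil\frac{n+1}{2}\rceil})>\dots>r(p_1,u_n),\\ r(p_1,v_1)<r(p_1,v_2)<\dots<r(p_1,v_{\lfloor\frac{n+1}{2}\rfloor})&=r(p_1,v_{\lceil\frac{n+1}{2}\rceil})>\dots>r(p_1,v_n). \end{align*} -/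

import Mathlib

open scoped Matrix

section Resistance

variable {V : Type*} [Fintype V] [DecidableEq V]

/-- `f` is an electric potential on the network obtained from `G` by replacing every edge with a
unit resistor, when a unit current enters at `a` and leaves at `b`: by Ohm's and Kirchhoff's laws
the net current `∑ y ∼ x, (f x - f y)` flowing out of a vertex `x` into its neighbours is the
external current supplied at `x`. -/
def IsUnitCurrentPotential (G : SimpleGraph V) [DecidableRel G.Adj] (a b : V) (f : V → ℝ) : Prop :=
  G.lapMatrix ℝ *ᵥ f = Pi.single a 1 - Pi.single b 1

open Classical in
/-- The resistance distance (effective resistance) between `a` and `b` in `G`: the potential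
difference between `a` and `b` when a unit current flows from `a` to `b`. It does not depend on
the chosen potential (`resistanceDist_eq`), and potentials exist whenever `G` is connected
(`exists_isUnitCurrentPotential`); the value `0` is used if there is none. -/
noncomputable def resistanceDist (G : SimpleGraph V) [DecidableRel G.Adj] (a b : V) : ℝ :=
  if h : ∃ f, IsUnitCurrentPotential G a b f then h.choose a - h.choose b else 0

theorem resistanceDist_eq {G : SimpleGraph V} [DecidableRel G.Adj] {a b : V} {f : V → ℝ}
    (hf : IsUnitCurrentPotential G a b f) : resistanceDist G a b = f a - f b := by
  have h : ∃ f, IsUnitCurrentPotential G a b f := ⟨f, hf⟩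
  have key : ∀ g h : V → ℝ, IsUnitCurrentPotential G a b g → h a - h b =
      h ⬝ᵥ (G.lapMatrix ℝ *ᵥ g) := by
    intro g h hg
    rw [show G.lapMatrix ℝ *ᵥ g = _ from hg, dotProduct_sub, dotProduct_single_one,
      dotProduct_single_one]
  rw [resistanceDist, dif_pos h, key f _ hf, key _ f h.choose_spec, Matrix.dotProduct_mulVec,
    ← Matrix.mulVec_transpose, (G.isSymm_lapMatrix ℝ).eq, dotProduct_comm]

theorem exists_isUnitCurrentPotential {G : SimpleGraph V} [DecidableRel G.Adj] (hG : G.Connected)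
    (a b : V) : ∃ f, IsUnitCurrentPotential G a b f := by
  have one_L : (1 : V → ℝ) ᵥ* G.lapMatrix ℝ = 0 := by
    rw [← Matrix.mulVec_transpose, (G.isSymm_lapMatrix ℝ).eq]
    exact G.lapMatrix_mulVec_const_eq_zero
  have hsum : ∀ f : V → ℝ, ∑ x, (G.lapMatrix ℝ *ᵥ f) x = 0 := by
    intro f
    rw [← one_dotProduct, Matrix.dotProduct_mulVec, one_L, zero_dotProduct]
  have hpos : (0 : ℝ) < Fintype.card V := by
    exact_mod_cast Fintype.card_pos_iff.2 ⟨a⟩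
  -- The Laplacian plus the all-ones matrix is invertible.
  let M : Matrix V V ℝ := G.lapMatrix ℝ + Matrix.of fun _ _ => 1
  have hM : ∀ (f : V → ℝ) (x : V), (M *ᵥ f) x = (G.lapMatrix ℝ *ᵥ f) x + ∑ y, f y := by
    intro f x
    rw [Matrix.add_mulVec, Pi.add_apply]
    congr 1
    simp [Matrix.mulVec, dotProduct]
  have total : ∀ f : V → ℝ, ∑ x, (M *ᵥ f) x = Fintype.card V * ∑ y, f y := by
    intro f
    simp only [hM, Finset.sum_add_distrib, hsum]
    simp
  have hinj : Function.Injective M.mulVec := by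
    intro f g hfg
    have h0 : M *ᵥ (f - g) = 0 := by
      rw [Matrix.mulVec_sub]
      exact sub_eq_zero.2 hfg
    have hs : ∑ y, (f - g) y = 0 := by
      have := total (f - g)
      rw [h0] at this
      simp only [Pi.zero_apply, Finset.sum_const_zero] at this
      exact (mul_eq_zero.1 this.symm).resolve_left hpos.ne'
    have hL : G.lapMatrix ℝ *ᵥ (f - g) = 0 := by
      ext x
      have := hM (f - g) x
      rw [h0, hs] at this
      simpa using this.symm
    have hc := G.lapMatrix_mulVec_eq_zero_iff_forall_reachable.1 hL
    ext x
    have hx : ∑ y, (f - g) y = Fintype.card V * (f - g) x := by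
      rw [Finset.sum_congr rfl fun y _ => hc y x (hG.preconnected y x)]
      simp only [Finset.sum_const, Finset.card_univ, nsmul_eq_mul]
    rw [hs] at hx
    exact sub_eq_zero.1 ((mul_eq_zero.1 hx.symm).resolve_left hpos.ne')
  obtain ⟨f, hf⟩ := Matrix.mulVec_surjective_iff_isUnit.2 (Matrix.mulVec_injective_iff_isUnit.1 hinj)
    (Pi.single a 1 - Pi.single b 1)
  refine ⟨f, ?_⟩
  have hs : ∑ y, f y = 0 := by
    have := total f
    rw [show M *ᵥ f = _ from hf] at this
    simp at this
    exact this.resolve_left (fun h => hpos.ne' (by simp [h]))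
  change G.lapMatrix ℝ *ᵥ f = _
  rw [← hf]
  ext x
  rw [hM f x, hs, add_zero]

end Resistance

/-- The four kinds of vertices `p_i`, `u_i`, `q_i`, `v_i` of a hexagonal cylinder chain. -/
inductive HexLabel
  | p
  | u
  | q
  | v
  deriving DecidableEq

instance : Fintype HexLabel where
  elems := {.p, .u, .q, .v}
  complete := by rintro (_ | _ | _ | _) <;> decide

/-- The vertices of the hexagonal cylinder chain with `n` hexagons; indices are read modulo `n`,
so that `p_0 = p_n`, `q_0 = q_n`, `u_0 = u_n` and `v_0 = v_n`. -/
abbrev HexVertex (n : ℕ) : Type := HexLabel × ZMod n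

/-- The edges of the chain, each listed in one orientation: `p_i u_i` and `u_i p_{i+1}` (upper
side), `q_i v_i` and `v_i q_{i+1}` (lower side), and `p_i q_i`. -/
def hexEdge (n : ℕ) : HexVertex n → HexVertex n → Prop
  | (.p, i), (.u, j) => j = i
  | (.u, i), (.p, j) => j = i + 1
  | (.q, i), (.v, j) => j = i
  | (.v, i), (.q, j) => j = i + 1
  | (.p, i), (.q, j) => j = i
  | _, _ => False

instance (n : ℕ) : DecidableRel (hexEdge n) := fun x y => by
  rcases x with ⟨_ | _ | _ | _, i⟩ <;> rcases y with ⟨_ | _ | _ | _, j⟩ <;>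
    unfold hexEdge <;> infer_instance

/-- The linear hexagonal cylinder chain `R_n`. Its `i`-th hexagon is the cycle
`p_{i-1}, u_{i-1}, p_i, q_i, v_{i-1}, q_{i-1}`, with indices modulo `n`. -/
def hexCylinder (n : ℕ) : SimpleGraph (HexVertex n) := SimpleGraph.fromRel (hexEdge n)

instance (n : ℕ) : DecidableRel (hexCylinder n).Adj :=
  inferInstanceAs (DecidableRel (SimpleGraph.fromRel (hexEdge n)).Adj)

/-- The resistance distance in `R_n` between the vertex with label `s` and index `j` and the vertex
with label `t` and index `i`, where indices are positive integers read modulo `n`. -/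
noncomputable def hexResistance (n : ℕ) [NeZero n] (s : HexLabel) (j : ℕ) (t : HexLabel) (i : ℕ) :
    ℝ :=
  resistanceDist (hexCylinder n) (s, (j : ZMod n)) (t, (i : ZMod n))

/-- The chain `f 1 < f 2 < ⋯ < f l = f m > ⋯ > f n`. -/
def RisesThenFalls (f : ℕ → ℝ) (l m n : ℕ) : Prop :=
  StrictMonoOn f (Set.Icc 1 l) ∧ f l = f m ∧ StrictAntiOn f (Set.Icc m n)

/-! The chain `R_n` is a ring of length `2n` (the vertices `p_i`, `u_i` in alternation) glued to a
second copy of itself (the `q_i`, `v_i`) by the edges `p_i q_i`. Its Laplacian therefore splits into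
a part symmetric under exchanging the two copies, the Laplacian of a cycle of length `2n`, and an
antisymmetric part, the same Laplacian with an extra mass `2` at each `p_i`. Both have closed-form
Green functions. If `x` denotes the position relative to the point antipodal to the source, so that
the source is at `x = n`, the symmetric one is `x² / (4n)` up to a constant, and the antisymmetric
one is a multiple of `cosh (xθ) / sinh (nθ)` with `sinh θ = 1`; the multiple depends only on
whether the two vertices have degree `2` or `3`. Half the sum (or difference) of the two is the
function `hexGreen`, and `lapMatrix_mulVec_hexGreen` is the verification that its Laplacian is a
point mass minus a constant. Hence (`resistanceDist_hexCylinder`)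
`r(a, b) = g(a, a) + g(b, b) - 2 g(a, b)`, where the first two terms do not depend on the position.

It remains to see that `g(a, b)`, which has the form
`x² / (8n) + κ / 4 * cosh (xθ) / sinh (nθ)` with `|κ| ≤ √2`, increases when `|x|` grows by `2`
within `[0, n]` (`ringGreen_lt_add_two`). The increment from `m - 1` to `m + 1` is a positive
multiple of `sinh (nθ) / n + κ sinh (mθ) / m`, so for negative `κ` the claim compares
`√2 sinh (mθ) / m` with `sinh (nθ) / n` for `1 ≤ m < n`. The former is at most
`sinh ((m + 1)θ) / (m + 1)`: for `m ≥ 2` strictly, by `sinh ((m + 1)θ) > (1 + √2) sinh (mθ)`, and for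
`m = 1` with equality, since `sinh (2θ) = 2√2`. This is why the pair `u`, `v`, the only one with
`κ = -√2`, needs `n ≥ 3`. -/

/-! ### Functions of the position on the ring -/

/-- The number `θ` with `sinh θ = 1` and `cosh θ = √2`. -/
noncomputable def decayRate : ℝ := Real.arsinh 1

theorem sinh_decayRate : Real.sinh decayRate = 1 := Real.sinh_arsinh 1

theorem cosh_decayRate : Real.cosh decayRate = √2 := by
  rw [decayRate, Real.cosh_arsinh]
  norm_num

theorem decayRate_pos : 0 < decayRate := Real.arsinh_pos_iff.2 one_pos

theorem sinh_mul_decayRate_pos {x : ℝ} (hx : 0 < x) : 0 < Real.sinh (x * decayRate) :=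
  Real.sinh_pos_iff.2 (mul_pos hx decayRate_pos)

/-- The Green function of the chain as a function of the position `x` on the ring, measured from the
point antipodal to the source. The quadratic term comes from the part symmetric under exchanging the
two sides of the chain, the hyperbolic one from the antisymmetric part; `κ` is the coefficient
`hexCoupling` determined by the kinds of the two vertices. -/
noncomputable def ringGreen (n : ℕ) (κ x : ℝ) : ℝ :=
  x ^ 2 / (8 * n) + κ / 4 * (Real.cosh (x * decayRate) / Real.sinh (n * decayRate))

theorem ringGreen_congr_abs {n : ℕ} {κ x y : ℝ} (h : |x| = |y|) :
    ringGreen n κ x = ringGreen n κ y := by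
  rcases abs_eq_abs.1 h with rfl | rfl
  · rfl
  · simp [ringGreen]

theorem ringGreen_eq_add (n : ℕ) (κ x : ℝ) :
    ringGreen n κ x = ringGreen n 0 x + κ * (ringGreen n 1 x - ringGreen n 0 x) := by
  simp only [ringGreen]
  ring

/-- Away from the source, summing over the two neighbours on the ring multiplies the hyperbolic term
by `2 cosh θ = 2√2`. -/
theorem ringGreen_neighbors {n : ℕ} (hn : n ≠ 0) (κ x : ℝ) :
    ringGreen n κ (x + 1) + ringGreen n κ (x - 1) =
      2 * ringGreen n (√2 * κ) x + 1 / (4 * n) := by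
  have hn' : (n : ℝ) ≠ 0 := Nat.cast_ne_zero.2 hn
  simp only [ringGreen, add_mul, sub_mul, one_mul, Real.cosh_add, Real.cosh_sub,
    sinh_decayRate, cosh_decayRate]
  field_simp
  ring

/-- At the source both neighbours on the ring are at position `±(n - 1)`; the defect compared with
`ringGreen_neighbors` is the injected current. -/
theorem ringGreen_neighbors_source {n : ℕ} (hn : n ≠ 0) (κ : ℝ) :
    2 * ringGreen n κ (n - 1) =
      2 * ringGreen n (√2 * κ) n + 1 / (4 * n) - (1 + κ) / 2 := by
  have hn' : (n : ℝ) ≠ 0 := Nat.cast_ne_zero.2 hn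
  have hs : Real.sinh (n * decayRate) ≠ 0 :=
    (sinh_mul_decayRate_pos (by positivity)).ne'
  simp only [ringGreen, sub_mul, one_mul, Real.cosh_sub, sinh_decayRate, cosh_decayRate]
  field_simp
  ring

/-! ### Growth of the hyperbolic sine -/

theorem sinh_succ_mul (m : ℕ) : Real.sinh ((m + 1 : ℕ) * decayRate) =
    √2 * Real.sinh (m * decayRate) + Real.cosh (m * decayRate) := by
  push_cast
  rw [add_mul, one_mul, Real.sinh_add, sinh_decayRate, cosh_decayRate]
  ring

theorem sinh_succ_div_lt {m : ℕ} (hm : 2 ≤ m) :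
    √2 * (Real.sinh (m * decayRate) / m) <
      Real.sinh ((m + 1 : ℕ) * decayRate) / (m + 1 : ℕ) := by
  have hm' : (2 : ℝ) ≤ m := by exact_mod_cast hm
  have hs := sinh_mul_decayRate_pos (x := m) (by linarith)
  have hc := Real.sinh_lt_cosh (m * decayRate)
  have h2 : √2 < 2 := by
    rw [Real.sqrt_lt' two_pos]
    norm_num
  rw [sinh_succ_mul, ← mul_div_assoc, div_lt_div_iff₀ (by linarith) (by positivity)]
  push_cast
  nlinarith [mul_lt_mul_of_pos_right hc (by linarith : (0 : ℝ) < m),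
    mul_pos hs (by linarith : (0 : ℝ) < m - √2)]

/-- Equality holds for `m = 1` in `sinh_succ_div_le`. -/
theorem sinh_two_div : √2 * (Real.sinh ((1 : ℕ) * decayRate) / (1 : ℕ)) =
    Real.sinh ((1 + 1 : ℕ) * decayRate) / (1 + 1 : ℕ) := by
  have h := sinh_succ_mul 1
  rw [Nat.cast_one, one_mul, sinh_decayRate, cosh_decayRate] at h
  rw [h, Nat.cast_one, one_mul, sinh_decayRate]
  push_cast
  ring

theorem sinh_succ_div_le {m : ℕ} (hm : 1 ≤ m) :
    √2 * (Real.sinh (m * decayRate) / m) ≤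
      Real.sinh ((m + 1 : ℕ) * decayRate) / (m + 1 : ℕ) := by
  rcases hm.eq_or_lt with rfl | hm
  · exact sinh_two_div.le
  · exact (sinh_succ_div_lt hm).le

theorem sinh_div_pos {m : ℕ} (hm : 1 ≤ m) : 0 < Real.sinh (m * decayRate) / m := by
  have : (0 : ℝ) < m := by exact_mod_cast hm
  exact div_pos (sinh_mul_decayRate_pos this) this

theorem sinh_div_lt {m n : ℕ} (hm : 1 ≤ m) (hmn : m < n) :
    Real.sinh (m * decayRate) / m < Real.sinh (n * decayRate) / n := by
  induction n, hmn using Nat.le_induction with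
  | base =>
    refine lt_of_lt_of_le ?_ (sinh_succ_div_le hm)
    exact lt_mul_of_one_lt_left (sinh_div_pos hm) Real.one_lt_sqrt_two
  | succ k hk ih =>
    refine ih.trans (lt_of_lt_of_le ?_ (sinh_succ_div_le (by omega)))
    exact lt_mul_of_one_lt_left (sinh_div_pos (by omega)) Real.one_lt_sqrt_two

theorem sqrt_two_mul_sinh_div_le {m n : ℕ} (hm : 1 ≤ m) (hmn : m < n) :
    √2 * (Real.sinh (m * decayRate) / m) ≤ Real.sinh (n * decayRate) / n := by
  rcases (show m + 1 ≤ n from hmn).eq_or_lt with rfl | h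
  · exact sinh_succ_div_le hm
  · exact (sinh_succ_div_le hm).trans (sinh_div_lt (by omega) h).le

theorem sqrt_two_mul_sinh_div_lt {m n : ℕ} (hm : 1 ≤ m) (hmn : m < n) (hn : 3 ≤ n) :
    √2 * (Real.sinh (m * decayRate) / m) < Real.sinh (n * decayRate) / n := by
  rcases (show m + 1 ≤ n from hmn).eq_or_lt with rfl | h
  · exact sinh_succ_div_lt (by omega)
  · exact (sinh_succ_div_le hm).trans_lt (sinh_div_lt (by omega) h)

/-- The Green function increases away from the antipode in steps of `2`, the distance between
consecutive vertices of the same kind. For `κ = -√2` and `n = 2` the two values are equal. -/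
theorem ringGreen_lt_add_two {n x : ℕ} {κ : ℝ} (hκ : -√2 < κ ∨ κ = -√2 ∧ 3 ≤ n)
    (hx : x + 2 ≤ n) : ringGreen n κ x < ringGreen n κ (x + 2 : ℕ) := by
  have hn : (0 : ℝ) < n := by exact_mod_cast (by omega : 0 < n)
  have hS := sinh_mul_decayRate_pos hn
  have hm : (0 : ℝ) < (x + 1 : ℕ) := by positivity
  have key : -κ * (Real.sinh ((x + 1 : ℕ) * decayRate) / (x + 1 : ℕ)) <
      Real.sinh (n * decayRate) / n := by
    rcases hκ with h | ⟨rfl, h⟩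
    · refine lt_of_lt_of_le ?_ (sqrt_two_mul_sinh_div_le (m := x + 1) (by omega) (by omega))
      exact mul_lt_mul_of_pos_right (by linarith) (sinh_div_pos (by omega))
    · rw [neg_neg]
      exact sqrt_two_mul_sinh_div_lt (by omega) (by omega) h
  have hcosh : Real.cosh ((x + 2 : ℕ) * decayRate) =
      Real.cosh (x * decayRate) + 2 * Real.sinh ((x + 1 : ℕ) * decayRate) := by
    have h1 : ((x + 2 : ℕ) : ℝ) * decayRate = (x + 1 : ℕ) * decayRate + decayRate := by
      push_cast; ring
    have h2 : (x : ℝ) * decayRate = (x + 1 : ℕ) * decayRate - decayRate := by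
      push_cast; ring
    rw [h1, h2, Real.cosh_add, Real.cosh_sub, sinh_decayRate]
    ring
  have hdiff : ringGreen n κ (x + 2 : ℕ) - ringGreen n κ x =
      (x + 1 : ℕ) / (2 * Real.sinh (n * decayRate)) *
        (Real.sinh (n * decayRate) / n +
          κ * (Real.sinh ((x + 1 : ℕ) * decayRate) / (x + 1 : ℕ))) := by
    rw [ringGreen, ringGreen, hcosh]
    field_simp
    push_cast
    ring
  have : 0 < ringGreen n κ (x + 2 : ℕ) - ringGreen n κ x := by
    rw [hdiff]
    exact mul_pos (by positivity) (by linarith)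
  linarith

/-! ### Sequences symmetric about a centre -/

/-- A sequence rises and then falls once its value at `i` is a decreasing function of the distance
`|N - 2i|` to the centre `N / 2`. Those distances all have the parity of `N` and, by the bounds on
`N`, are at most `n`, so comparing distances `x` and `x + 2` is enough. -/
theorem risesThenFalls_of_reflection {n N : ℕ} (hN : n + 1 ≤ N) (hN' : N ≤ n + 2) (hn : 2 ≤ n)
    {F : ℕ → ℝ} (hF : ∀ x, x + 2 ≤ n → F x < F (x + 2)) {f : ℕ → ℝ} {K : ℝ}
    (hf : ∀ i ∈ Set.Icc 1 n, f i = K - F ((N : ℤ) - 2 * i).natAbs) :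
    RisesThenFalls f (N / 2) (N ⌈/⌉ 2) n := by
  have hF' : ∀ x j : ℕ, x + 2 * (j + 1) ≤ n → F x < F (x + 2 * (j + 1)) := by
    intro x j
    induction j with
    | zero => exact hF x
    | succ j ih => exact fun h => (ih (by omega)).trans (hF (x + 2 * (j + 1)) (by omega))
  have hlt : ∀ {x y : ℕ}, x < y → y ≤ n → y % 2 = x % 2 → F x < F y := by
    intro x y hxy hy hp
    have := hF' x ((y - x) / 2 - 1) (by omega)
    rwa [show x + 2 * ((y - x) / 2 - 1 + 1) = y by omega] at this
  rw [Nat.ceilDiv_eq_add_pred_div]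
  refine ⟨fun i hi i' hi' h => ?_, ?_, fun i hi i' hi' h => ?_⟩
  · rw [Set.mem_Icc] at hi hi'
    rw [hf i ⟨by omega, by omega⟩, hf i' ⟨by omega, by omega⟩]
    exact sub_lt_sub_left (hlt (by omega) (by omega) (by omega)) K
  · rw [hf _ ⟨by omega, by omega⟩, hf _ ⟨by omega, by omega⟩]
    congr 2
    omega
  · rw [Set.mem_Icc] at hi hi'
    rw [hf i ⟨by omega, by omega⟩, hf i' ⟨by omega, by omega⟩]
    exact sub_lt_sub_left (hlt (by omega) (by omega) (by omega)) K

section Chain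

variable {n : ℕ}

/-! ### The Green function -/

/-- The signed position on the ring of length `2n` of a vertex that is `k` hexagons away from the
source, where `k` is represented in `[0, n)`. The origin is the point antipodal to the source and
hexagons have length `2`, so the source itself sits at `n`. Going once around the ring jumps from
`-n` to `n`, so only `|ringPos k|` has a meaning independent of the choice of representatives. -/
def ringPos (k : ZMod n) : ℝ := n - 2 * k.val

theorem ringPos_zero : ringPos (0 : ZMod n) = n := by simp [ringPos]

/-- The signed position on the ring (see `ringPos`) of a vertex with label `t` whose index exceeds
that of the source, with label `s`, by `k`. A middle vertex `u` or `v` lies half a hexagon beyond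
the `p` or `q` of the same index. Seen from a middle vertex, the `p` or `q` with index difference
`k` lies half a hexagon beyond index difference `k - 1`. -/
def hexOffset : HexLabel → HexLabel → ZMod n → ℝ
  | .p, .p, k | .p, .q, k | .q, .p, k | .q, .q, k => ringPos k
  | .u, .u, k | .u, .v, k | .v, .u, k | .v, .v, k => ringPos k
  | .p, .u, k | .p, .v, k | .q, .u, k | .q, .v, k => ringPos k - 1
  | .u, .p, k | .u, .q, k | .v, .p, k | .v, .q, k => ringPos (k - 1) - 1

/-- The coefficient of the hyperbolic term of the Green function for the labels of the two vertices:
`w_s w_t / √2` with weight `1` for `p`, `q` and `√2` for `u`, `v`, negated when the vertices lie on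
different sides of the chain. -/
noncomputable def hexCoupling : HexLabel → HexLabel → ℝ
  | .p, .p | .q, .q => √2 / 2
  | .p, .q | .q, .p => -(√2 / 2)
  | .u, .u | .v, .v => √2
  | .u, .v | .v, .u => -√2
  | .p, .u | .u, .p | .q, .v | .v, .q => 1
  | .p, .v | .v, .p | .q, .u | .u, .q => -1

/-- A Green function of the chain: the potential at `b` for a unit current entering at `a` and
leaving uniformly through all vertices (`lapMatrix_mulVec_hexGreen`). The additive constant is chosen
so that the function is symmetric. -/
noncomputable def hexGreen (a b : HexVertex n) : ℝ :=
  ringGreen n (hexCoupling a.1 b.1) (hexOffset a.1 b.1 (b.2 - a.2))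

theorem hexGreen_self (t : HexLabel) (i : ZMod n) :
    hexGreen (t, i) (t, i) = ringGreen n (hexCoupling t t) n := by
  rw [hexGreen, sub_self]
  cases t <;> simp only [hexOffset, ringPos_zero]

theorem ringPos_natCast_sub_one {i : ℕ} (hi : i ∈ Set.Icc 1 n) :
    ringPos ((i : ZMod n) - ((1 : ℕ) : ZMod n)) = n + 2 - 2 * i := by
  have h := hi.1
  have h' := hi.2
  rw [← Nat.cast_sub h, ringPos, ZMod.val_cast_of_lt (by omega), Nat.cast_sub h]
  push_cast
  ring

/-! ### The Laplacian of the chain -/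

theorem lapMatrix_mulVec_eq_sum {V : Type*} [Fintype V] [DecidableEq V] (G : SimpleGraph V)
    [DecidableRel G.Adj] (f : V → ℝ) (x : V) :
    (G.lapMatrix ℝ *ᵥ f) x = ∑ y ∈ G.neighborFinset x, (f x - f y) := by
  rw [SimpleGraph.lapMatrix_mulVec_apply, Finset.sum_sub_distrib, Finset.sum_const,
    SimpleGraph.card_neighborFinset_eq_degree, nsmul_eq_mul]

theorem zmod_ne_add_one (hn : 2 ≤ n) (i : ZMod n) : i ≠ i + 1 := by
  have : Fact (1 < n) := ⟨hn⟩
  simp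

theorem hexCylinder_adj (a b : HexVertex n) :
    (hexCylinder n).Adj a b ↔ a ≠ b ∧ (hexEdge n a b ∨ hexEdge n b a) := Iff.rfl

variable [NeZero n]

theorem lapMatrix_hexCylinder_p (hn : 2 ≤ n) (f : HexVertex n → ℝ) (i : ZMod n) :
    ((hexCylinder n).lapMatrix ℝ *ᵥ f) (.p, i) =
      3 * f (.p, i) - f (.u, i) - f (.u, i - 1) - f (.q, i) := by
  have h : (hexCylinder n).neighborFinset (.p, i) = {(.u, i), (.u, i - 1), (.q, i)} := by
    ext ⟨_ | _ | _ | _, j⟩ <;>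
      simp [hexCylinder_adj, hexEdge, eq_sub_iff_add_eq, eq_comm]
  have := zmod_ne_add_one hn (i - 1)
  rw [lapMatrix_mulVec_eq_sum, h, Finset.sum_insert, Finset.sum_insert, Finset.sum_singleton]
  · ring
  · simp
  · simpa [eq_comm] using this

theorem lapMatrix_hexCylinder_q (hn : 2 ≤ n) (f : HexVertex n → ℝ) (i : ZMod n) :
    ((hexCylinder n).lapMatrix ℝ *ᵥ f) (.q, i) =
      3 * f (.q, i) - f (.v, i) - f (.v, i - 1) - f (.p, i) := by
  have h : (hexCylinder n).neighborFinset (.q, i) = {(.v, i), (.v, i - 1), (.p, i)} := by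
    ext ⟨_ | _ | _ | _, j⟩ <;>
      simp [hexCylinder_adj, hexEdge, eq_sub_iff_add_eq, eq_comm]
  have := zmod_ne_add_one hn (i - 1)
  rw [lapMatrix_mulVec_eq_sum, h, Finset.sum_insert, Finset.sum_insert, Finset.sum_singleton]
  · ring
  · simp
  · simpa [eq_comm] using this

theorem lapMatrix_hexCylinder_u (hn : 2 ≤ n) (f : HexVertex n → ℝ) (i : ZMod n) :
    ((hexCylinder n).lapMatrix ℝ *ᵥ f) (.u, i) =
      2 * f (.u, i) - f (.p, i) - f (.p, i + 1) := by
  have h : (hexCylinder n).neighborFinset (.u, i) = {(.p, i), (.p, i + 1)} := by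
    ext ⟨_ | _ | _ | _, j⟩ <;>
      simp [hexCylinder_adj, hexEdge, eq_comm, or_comm]
  rw [lapMatrix_mulVec_eq_sum, h, Finset.sum_pair (by simpa using zmod_ne_add_one hn i)]
  ring

theorem lapMatrix_hexCylinder_v (hn : 2 ≤ n) (f : HexVertex n → ℝ) (i : ZMod n) :
    ((hexCylinder n).lapMatrix ℝ *ᵥ f) (.v, i) =
      2 * f (.v, i) - f (.q, i) - f (.q, i + 1) := by
  have h : (hexCylinder n).neighborFinset (.v, i) = {(.q, i), (.q, i + 1)} := by
    ext ⟨_ | _ | _ | _, j⟩ <;>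
      simp [hexCylinder_adj, hexEdge, eq_comm, or_comm]
  rw [lapMatrix_mulVec_eq_sum, h, Finset.sum_pair (by simpa using zmod_ne_add_one hn i)]
  ring

/-! ### The Laplacian of the Green function -/

theorem zmod_val_add_one_of_ne {k : ZMod n} (h : k + 1 ≠ 0) : (k + 1).val = k.val + 1 := by
  have hlt := k.val_lt
  have hk : k + 1 = ((k.val + 1 : ℕ) : ZMod n) := by simp
  have hne : k.val + 1 ≠ n := fun h' => h (by rw [hk, h', ZMod.natCast_self])
  conv_lhs => rw [hk]
  exact ZMod.val_cast_of_lt (by omega)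

theorem zmod_val_add_one_of_eq {k : ZMod n} (h : k + 1 = 0) : k.val + 1 = n := by
  have hlt := k.val_lt
  have hk : ((k.val + 1 : ℕ) : ZMod n) = 0 := by simpa using h
  have := Nat.le_of_dvd (by omega) ((ZMod.natCast_eq_zero_iff _ _).1 hk)
  omega

theorem ringPos_add_one {k : ZMod n} (h : k + 1 ≠ 0) : ringPos (k + 1) = ringPos k - 2 := by
  rw [ringPos, ringPos, zmod_val_add_one_of_ne h]
  push_cast
  ring

theorem ringPos_of_add_one_eq_zero {k : ZMod n} (h : k + 1 = 0) : ringPos k = 2 - n := by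
  have : (k.val : ℝ) + 1 = n := by exact_mod_cast zmod_val_add_one_of_eq h
  rw [ringPos, ← this]
  ring

theorem abs_ringPos_add_one (k : ZMod n) : |ringPos (k + 1)| = |ringPos k - 2| := by
  by_cases h : k + 1 = 0
  · rw [h, ringPos_zero, ringPos_of_add_one_eq_zero h, abs_eq_abs]
    right; ring
  · rw [ringPos_add_one h]

theorem abs_ringPos_neg (k : ZMod n) : |ringPos (-k)| = |ringPos k| := by
  by_cases h : k = 0
  · simp [h]
  · have : NeZero k := ⟨h⟩
    rw [ringPos, ringPos, ZMod.val_neg_of_ne_zero, Nat.cast_sub k.val_lt.le, abs_eq_abs]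
    right; ring

theorem abs_ringPos_neg_sub_one (k : ZMod n) : |ringPos (-k - 1) - 1| = |ringPos k - 1| := by
  have hk : -(k + 1) = -k - 1 := by ring
  rw [← hk]
  by_cases h : k + 1 = 0
  · rw [h, neg_zero, ringPos_zero, ringPos_of_add_one_eq_zero h, abs_eq_abs]
    right; ring
  · have : NeZero (k + 1) := ⟨h⟩
    rw [ringPos, ringPos, ZMod.val_neg_of_ne_zero, Nat.cast_sub (k + 1).val_lt.le,
      zmod_val_add_one_of_ne h, abs_eq_abs]
    right; push_cast; ring

theorem hexGreen_comm (a b : HexVertex n) : hexGreen a b = hexGreen b a := by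
  obtain ⟨s, j⟩ := a
  obtain ⟨t, i⟩ := b
  have h1 := abs_ringPos_neg (i - j)
  have h2 := abs_ringPos_neg_sub_one (i - j)
  have h3 := abs_ringPos_neg_sub_one (j - i)
  rw [neg_sub] at h1 h2 h3
  have hc : hexCoupling s t = hexCoupling t s := by cases s <;> cases t <;> rfl
  unfold hexGreen
  rw [hc]
  apply ringGreen_congr_abs
  cases s <;> cases t <;> simp only [hexOffset, h1, h2, h3]

/-- The sum of the Green function over the two neighbours halfway to the next hexagons, for a vertex
of the same kind (degree `2` or `3`) as the source. -/
theorem ringGreen_around_vertex (κ : ℝ) (k : ZMod n) :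
    ringGreen n κ (ringPos k - 1) + ringGreen n κ (ringPos (k - 1) - 1) =
      2 * ringGreen n (√2 * κ) (ringPos k) + 1 / (4 * n) -
        (1 + κ) / 2 * (if k = 0 then 1 else 0) := by
  have hn := NeZero.ne n
  by_cases h : k = 0
  · subst h
    have h1 : ringGreen n κ (ringPos (0 - 1 : ZMod n) - 1) = ringGreen n κ (n - 1) := by
      apply ringGreen_congr_abs
      rw [ringPos_of_add_one_eq_zero (by ring), abs_eq_abs]
      right; ring
    rw [h1, ringPos_zero, if_pos rfl, mul_one, ← ringGreen_neighbors_source hn]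
    ring
  · have h1 : ringPos k = ringPos (k - 1) - 2 := by
      rw [← ringPos_add_one (by simpa using h), sub_add_cancel]
    have h2 : ringPos (k - 1) - 1 = ringPos k + 1 := by rw [h1]; ring
    rw [if_neg h, mul_zero, sub_zero, ← ringGreen_neighbors hn, h2, add_comm]

/-- The same sum for a vertex of the other kind than the source; such a vertex is never the source
itself, so no current is injected there. -/
theorem ringGreen_around_middle (κ : ℝ) (k : ZMod n) :
    ringGreen n κ (ringPos k) + ringGreen n κ (ringPos (k + 1)) =
      2 * ringGreen n (√2 * κ) (ringPos k - 1) + 1 / (4 * n) := by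
  rw [← ringGreen_neighbors (NeZero.ne n), ringGreen_congr_abs (abs_ringPos_add_one k)]
  ring_nf

/-- The chain has `4n` vertices, so the constant `1 / (4n)` withdraws exactly the unit current that
enters at `a`. -/
theorem lapMatrix_mulVec_hexGreen (hn : 2 ≤ n) (a b : HexVertex n) :
    ((hexCylinder n).lapMatrix ℝ *ᵥ hexGreen a) b =
      (Pi.single a 1 : HexVertex n → ℝ) b - 1 / (4 * n) := by
  obtain ⟨s, j⟩ := a
  obtain ⟨t, i⟩ := b
  have e1 : i - 1 - j = i - j - 1 := by ring
  have e2 : i + 1 - j = i - j + 1 := by ring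
  have hij : i = j ↔ i - j = 0 := sub_eq_zero.symm
  have h2 : √2 * √2 = 2 := by simp
  have h3 : √2 * (√2 / 2) = 1 := by rw [← mul_div_assoc, h2]; norm_num
  have hV₁ := ringGreen_around_vertex 1 (i - j)
  have hV₂ := ringGreen_around_vertex (-1) (i - j)
  have hM₁ := ringGreen_around_middle (√2 / 2) (i - j)
  have hM₂ := ringGreen_around_middle (-(√2 / 2)) (i - j)
  have hM₃ := ringGreen_around_middle √2 (i - j - 1)
  have hM₄ := ringGreen_around_middle (-√2) (i - j - 1)
  simp only [mul_neg, h2, h3, sub_add_cancel] at hM₁ hM₂ hM₃ hM₄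
  -- With the Green function written as `A x + κ * B x`, each equation is linear in the values of
  -- `A` and `B` and is a multiple of one of the six sums above.
  obtain ⟨A, B, hAB⟩ : ∃ A B : ℝ → ℝ, ∀ κ x, ringGreen n κ x = A x + κ * B x :=
    ⟨_, _, fun κ x => ringGreen_eq_add n κ x⟩
  simp only [hAB] at hV₁ hV₂ hM₁ hM₂ hM₃ hM₄
  rcases t <;>
  simp only [lapMatrix_hexCylinder_p hn, lapMatrix_hexCylinder_q hn, lapMatrix_hexCylinder_u hn,
    lapMatrix_hexCylinder_v hn, hexGreen, e1, e2, hAB] <;>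
  rcases s <;>
  simp only [hexCoupling, hexOffset, Pi.single_apply, Prod.mk.injEq, reduceCtorEq, false_and,
    true_and, if_false, hij, add_sub_cancel_right] <;>
  first
  | linear_combination -hV₁
  | linear_combination -hV₂
  | linear_combination -hM₁
  | linear_combination -hM₂
  | linear_combination -hM₃
  | linear_combination -hM₄

theorem resistanceDist_hexCylinder (hn : 2 ≤ n) (a b : HexVertex n) :
    resistanceDist (hexCylinder n) a b =
      hexGreen a a + hexGreen b b - 2 * hexGreen a b := by
  have h : IsUnitCurrentPotential (hexCylinder n) a b (hexGreen a - hexGreen b) := by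
    ext x
    rw [Matrix.mulVec_sub, Pi.sub_apply, Pi.sub_apply, lapMatrix_mulVec_hexGreen hn,
      lapMatrix_mulVec_hexGreen hn]
    ring
  rw [resistanceDist_eq h, Pi.sub_apply, Pi.sub_apply, hexGreen_comm b a]
  ring

/-! ### Monotonicity of the resistance distances -/

/-- The centre of the sequence is `N / 2`, where `N = n + 2` for two vertices of the same kind and
`N = n + 1` if the target lies half a hexagon further along the ring. -/
theorem risesThenFalls_hexResistance (hn : 2 ≤ n) {s t : HexLabel} {N : ℕ} (hN : n + 1 ≤ N)
    (hN' : N ≤ n + 2)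
    (hoff : ∀ k : ZMod n, hexOffset s t k = ringPos k + (N - (n + 2)))
    (hκ : -√2 < hexCoupling s t ∨ hexCoupling s t = -√2 ∧ 3 ≤ n) :
    RisesThenFalls (fun i => hexResistance n s 1 t i) (N / 2) (N ⌈/⌉ 2) n := by
  refine risesThenFalls_of_reflection hN hN' hn
    (F := fun x => 2 * ringGreen n (hexCoupling s t) x)
    (K := ringGreen n (hexCoupling s s) n + ringGreen n (hexCoupling t t) n)
    (fun x hx => mul_lt_mul_of_pos_left (ringGreen_lt_add_two hκ hx) two_pos)
    fun i hi => ?_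
  have h : hexGreen (s, ((1 : ℕ) : ZMod n)) (t, (i : ZMod n)) =
      ringGreen n (hexCoupling s t) (((N : ℤ) - 2 * i).natAbs : ℕ) := by
    apply ringGreen_congr_abs
    rw [hoff, ringPos_natCast_sub_one hi, Nat.cast_natAbs]
    push_cast
    rw [abs_abs]
    ring_nf
  simp only [hexResistance]
  rw [resistanceDist_hexCylinder hn, hexGreen_self, hexGreen_self, h]

end Chain

theorem lemma4p3 (n : ℕ) [NeZero n] (hn : 2 ≤ n) :
    RisesThenFalls (fun i => hexResistance n .p 1 .p i) ((n + 2) / 2) ((n + 2) ⌈/⌉ 2) n ∧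
    RisesThenFalls (fun i => hexResistance n .p 1 .q i) ((n + 2) / 2) ((n + 2) ⌈/⌉ 2) n ∧
    RisesThenFalls (fun i => hexResistance n .u 1 .u i) ((n + 2) / 2) ((n + 2) ⌈/⌉ 2) n ∧
    (n ≠ 2 →
      RisesThenFalls (fun i => hexResistance n .u 1 .v i) ((n + 2) / 2) ((n + 2) ⌈/⌉ 2) n) ∧
    RisesThenFalls (fun i => hexResistance n .p 1 .u i) ((n + 1) / 2) ((n + 1) ⌈/⌉ 2) n ∧
    RisesThenFalls (fun i => hexResistance n .p 1 .v i) ((n + 1) / 2) ((n + 1) ⌈/⌉ 2) n := by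
  have h0 : 0 < √2 := by positivity
  have h1 := Real.one_lt_sqrt_two
  refine ⟨?_, ?_, ?_, fun hn2 => ?_, ?_, ?_⟩
  · refine risesThenFalls_hexResistance hn (by omega) le_rfl (fun k => ?_) (Or.inl ?_)
    · simp [hexOffset]
    · simp only [hexCoupling]; linarith
  · refine risesThenFalls_hexResistance hn (by omega) le_rfl (fun k => ?_) (Or.inl ?_)
    · simp [hexOffset]
    · simp only [hexCoupling]; linarith
  · refine risesThenFalls_hexResistance hn (by omega) le_rfl (fun k => ?_) (Or.inl ?_)
    · simp [hexOffset]
    · simp only [hexCoupling]; linarith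
  · refine risesThenFalls_hexResistance hn (by omega) le_rfl (fun k => ?_)
      (Or.inr ⟨rfl, by omega⟩)
    simp [hexOffset]
  · refine risesThenFalls_hexResistance hn le_rfl (by omega) (fun k => ?_) (Or.inl ?_)
    · simp only [hexOffset]; push_cast; ring
    · simp only [hexCoupling]; linarith
  · refine risesThenFalls_hexResistance hn le_rfl (by omega) (fun k => ?_) (Or.inl ?_)
    · simp only [hexOffset]; push_cast; ring
    · simp only [hexCoupling]; linarith
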